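/- Let $T$ be a counted liftable FO-dtree, i.e. a first-order decomposition tree in normal form (logvar domains are identical or disjoint, logvars with the same domain denote different objects, and differ from the constants of the model) with the following properties. Its leaves hold factors on representative randvars. Each of its inner nodes is either an ordinary node or a DPG node $T_{\mathbf X}$, for a set $\mathbf X$ of $k\ge 1$ logvars with a common domain; the single child $T_{\mathbf x}$ of $T_{\mathbf X}$ stands for all its isomorphic instances, one for each $k$-subset of the domain that satisfies the constraint, and has $k!$ children that are isomorphic up to permutation of the $k$ representative objects $\mathbf x$, which occur in every leaf below. In the propositional dtree that $T$ defines, the cutset of a node consists of the randvars shared by two of its children and not in the cutset of an ancestor, its context consists of its randvars that are in the cutset of an ancestor, and its cluster is the union of cutset and context (for a leaf: all its randvars). Each cluster consists only of (representative) ground randvars and of PRVs with one logvar, and the latter are grouped, in a way that can be carried out by counting conversions, into counting randvars $\#_X[P_1(X),\dots,P_j(X)]$, whose values are histograms. Lifted variable elimination along $T$ works bottom-up. At each node it multiplies the factors received from the children (at a DPG node it aggregates or count-converts the one factor computed for the representative child, by exponentiation of entries) into a factor on the cluster and sums out the randvars that are not in the context. Its running time is the number of additions and multiplications of table entries, where powers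 are computed by repeated squaring and the integer multiplicities and exponents, which are determined by the histograms, are taken as given. Then the running time of lifted variable elimination along $T$ is $$O\big(n_T\cdot\log n\cdot d^{\,w_g}\cdot n_\#^{\,w_\#\cdot r_\#}\big)$$ with an absolute implied constant. Here $n_T$ is the number of nodes of $T$; $(w_g,w_\#)$ is the lifted width of $T$, i.e. $w_g$ is the largest number of ground randvars and $w_\#$ the largest number of counting randvars in a cluster of $T$; $d$ is the largest range size of a ground randvar in a cluster (so that $d^{\,w_g}$ is the factor $\exp(w_g)$); $n$ is the largest domain size of a logvar and $n_\#$ the largest domain size of a counted logvar (each replaced by $2$ if it is smaller than $2$ or if there is no such logvar); and $r_\#$ is the largest range size of a tuple $(P_1(X),\dots,P_j(X))$ inside a counting randvar (and $0$ if there is none). -/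

import Mathlib

/-! # Lifted variable elimination on counted first-order decomposition trees -/

namespace Lifted

/-! ## Randvars -/

/-- The symbols of a parfactor model: finitely many pairwise disjoint logvar domains with their
sizes, and finitely many predicates with their arities and with the sizes of their ranges. -/
structure Vocabulary where
  numDom : ℕ
  size : Fin numDom → ℕ
  numPred : ℕ
  arity : Fin numPred → ℕ
  rng : Fin numPred → ℕ
  rng_pos : ∀ P, 0 < rng P

/-- Objects: an object belongs to exactly one domain. -/
abbrev Obj (L : Vocabulary) := Σ δ : Fin L.numDom, Fin (L.size δ)

/-- Ground randvars `P(o₁, …, oₐ)`. -/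
abbrev Randvar (L : Vocabulary) := Σ P : Fin L.numPred, (Fin (L.arity P) → Obj L)

/-- Joint assignments of values to all ground randvars. -/
abbrev Assignment (L : Vocabulary) := ∀ a : Randvar L, Fin (L.rng a.1)

instance (L : Vocabulary) : Inhabited (Assignment L) := ⟨fun a => ⟨0, L.rng_pos a.1⟩⟩

/-- Representative randvars in a scope of `m` named objects (constants and representative objects):
all arguments are names. -/
abbrev RepRandvar (L : Vocabulary) (m : ℕ) := Σ P : Fin L.numPred, (Fin (L.arity P) → Fin m)

/-- The ground randvar that a representative randvar denotes when the names denote the objects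
`ρ`. -/
def RepRandvar.ground {L : Vocabulary} {m : ℕ} (a : RepRandvar L m) (ρ : Fin m → Obj L) :
    Randvar L :=
  ⟨a.1, fun i => ρ (a.2 i)⟩

/-- Parametrized randvars with one logvar `X`, in a scope of `m` named objects: the domain of `X`,
the predicate, and for each argument either a name (`some j`) or the logvar `X` (`none`). -/
abbrev PRV (L : Vocabulary) (m : ℕ) :=
  Fin L.numDom × (Σ P : Fin L.numPred, (Fin (L.arity P) → Option (Fin m)))

namespace PRV

variable {L : Vocabulary} {m : ℕ}

/-- The domain of the logvar. -/
def dom (p : PRV L m) : Fin L.numDom := p.1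

/-- The size of the range of the randvars that the PRV represents. -/
def rng (p : PRV L m) : ℕ := L.rng p.2.1

/-- The randvar obtained by substituting the object `o` for the logvar. -/
def ground (p : PRV L m) (ρ : Fin m → Obj L) (o : Fin (L.size p.dom)) : Randvar L :=
  ⟨p.2.1, fun i => (p.2.2 i).elim ⟨p.dom, o⟩ ρ⟩

/-- The randvar `a` is represented by `p`. The logvar really occurs, and it is
constrained to differ from all named objects (normal form). -/
def Represents (p : PRV L m) (ρ : Fin m → Obj L) (a : Randvar L) : Prop :=
  (∃ i, p.2.2 i = none) ∧
    ∃ o : Fin (L.size p.dom), (∀ j, ρ j ≠ ⟨p.dom, o⟩) ∧ p.ground ρ o = a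

end PRV

/-! ## Sets of randvars written with ground randvars and counting randvars -/

/-- A set of randvars as it is seen from a node of a counted tree: the objects `env` denoted by the
names in scope, the set `rvs`, and a grouping of one-logvar PRVs. The PRVs of one domain with the same
label form together the tuple `P₁(X), …, Pₖ(X)` of a counting randvar `#_X[P₁(X), …, Pₖ(X)]`. -/
structure CSet (L : Vocabulary) (m : ℕ) where
  env : Fin m → Obj L
  rvs : Finset (Randvar L)
  label : PRV L m → ℕ

/-- The joint values of a set that is written with ground randvars and counting randvars: a value for
each ground randvar, and for each counting randvar a histogram, which maps each value of the
tuple of PRVs to a number of objects. -/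
abbrev Key (L : Vocabulary) (m : ℕ) :=
  (RepRandvar L m → ℕ) × (Fin L.numDom × ℕ → (PRV L m → ℕ) → ℕ)

namespace CSet

variable {L : Vocabulary} {m : ℕ}

open Classical in
/-- The (representative) ground randvars in the set. -/
noncomputable def groundRvs (S : CSet L m) : Finset (RepRandvar L m) :=
  Finset.univ.filter fun a => a.ground S.env ∈ S.rvs

open Classical in
/-- The one-logvar PRVs in the set. -/
noncomputable def prvs (S : CSet L m) : Finset (PRV L m) :=
  Finset.univ.filter fun p => ∃ a ∈ S.rvs, p.Represents S.env a

/-- The set consists only of (representative) ground randvars and one-logvar PRVs. -/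
def Liftable (S : CSet L m) : Prop :=
  ∀ a ∈ S.rvs, (∃ b : RepRandvar L m, b.ground S.env = a) ∨ ∃ p : PRV L m, p.Represents S.env a

/-- The counting randvars in the set, each named by the domain of its logvar and by the label of its
tuple of PRVs. -/
noncomputable def countingRvs (S : CSet L m) : Finset (Fin L.numDom × ℕ) :=
  S.prvs.image fun p => (p.dom, S.label p)

/-- The tuple of PRVs inside a counting randvar. -/
noncomputable def tuple (S : CSet L m) (γ : Fin L.numDom × ℕ) : Finset (PRV L m) :=
  S.prvs.filter fun p => (p.dom, S.label p) = γ

/-- The number of ground randvars. -/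
noncomputable def groundWidth (S : CSet L m) : ℕ := S.groundRvs.card

/-- The number of counting randvars. -/
noncomputable def countingWidth (S : CSet L m) : ℕ := S.countingRvs.card

/-- The largest range size of a ground randvar in the set. -/
noncomputable def groundRange (S : CSet L m) : ℕ := S.groundRvs.sup fun a => L.rng a.1

/-- The largest domain size of a counted logvar. -/
noncomputable def countedDomain (S : CSet L m) : ℕ := S.countingRvs.sup fun γ => L.size γ.1

/-- The largest range size of a tuple of counted PRVs. -/
noncomputable def countedRange (S : CSet L m) : ℕ :=
  S.countingRvs.sup fun γ => ∏ p ∈ S.tuple γ, p.rng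

/-- The joint value, under the assignment `g`, of the randvars that arise from the PRVs in `Q` (all
with domain `δ`) when the object `o` is substituted for their logvar. -/
noncomputable def tupleValue (S : CSet L m) (Q : Finset (PRV L m)) (δ : Fin L.numDom)
    (g : Assignment L) (o : Fin (L.size δ)) : PRV L m → ℕ :=
  fun p => if h : p ∈ Q ∧ p.dom = δ then (g (p.ground S.env (h.2 ▸ o)) : ℕ) else 0

open Classical in
/-- The value of the set under an assignment: the values of its ground randvars and the histograms
of its counting randvars. -/
noncomputable def key (S : CSet L m) (g : Assignment L) : Key L m :=
  (fun a => if a ∈ S.groundRvs then (g (a.ground S.env) : ℕ) else 0,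
   fun γ v => if γ ∈ S.countingRvs then
      (Finset.univ.filter fun o : Fin (L.size γ.1) =>
        (∀ j, S.env j ≠ ⟨γ.1, o⟩) ∧ S.tupleValue (S.tuple γ) γ.1 g o = v).card
    else 0)

open Classical in
/-- The range of the set: all the values that it can take. -/
noncomputable def range (S : CSet L m) : Finset (Key L m) := Finset.univ.image S.key

open Classical in
/-- Some assignment under which the set has the given value. -/
noncomputable def assignment (S : CSet L m) (κ : Key L m) : Assignment L :=
  if h : ∃ g, S.key g = κ then h.choose else default

open Classical in
/-- The multiplicity of a value `κ` of `S` when the randvars outside of `C` are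
summed out: the number of assignments to these randvars that yield the value `κ`. -/
noncomputable def mul (S C : CSet L m) (κ : Key L m) : ℕ :=
  (Finset.univ.filter fun g : Assignment L =>
    (∀ a, a ∉ S.rvs \ C.rvs → g a = S.assignment κ a) ∧ S.key g = κ).card

end CSet

/-! ## Counted FO-dtrees -/

/-- Counted FO-dtrees in a scope of `m` named objects.

* A leaf holds a factor on representative randvars.
* An ordinary inner node has one or more children.
* `dpg δ k l l' t` is a DPG node `T_𝐗` for `k` logvars `𝐗` with domain `δ`, together with its only
  child `T_𝐱`, where `𝐱` are `k` representative objects, which get the names `m, …, m + k - 1`.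
  The `k!` children of `T_𝐱` are the copies of `t` under the permutations of these `k` names.
  The constraint of the node says that the objects `𝐱` differ from one another and from all objects
  named before (normal form).

Each inner node carries the grouping of its one-logvar PRVs into counting randvars (`l` belongs to
`T_𝐗` and `l'` to `T_𝐱`). -/
inductive FODtree (L : Vocabulary) : ℕ → Type
  | leaf {m : ℕ} (s : ℕ) (args : Fin s → RepRandvar L m)
      (φ : (∀ i, Fin (L.rng (args i).1)) → ℝ) : FODtree L m
  | node {m : ℕ} (l : PRV L m → ℕ) (r : ℕ) (ts : Fin (r + 1) → FODtree L m) : FODtree L m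
  | dpg {m : ℕ} (δ : Fin L.numDom) (k : ℕ) (l : PRV L m → ℕ) (l' : PRV L (m + k) → ℕ)
      (t : FODtree L (m + k)) : FODtree L m

/-- The `k`-subsets of the objects of the domain `δ` that are not named by `ρ`, each listed in
increasing order. -/
def subsets {L : Vocabulary} {m : ℕ} (ρ : Fin m → Obj L) (δ : Fin L.numDom) (k : ℕ) :
    Finset (Fin k → Fin (L.size δ)) :=
  Finset.univ.filter fun x => (∀ i j, i < j → x i < x j) ∧ ∀ i j, ρ j ≠ ⟨δ, x i⟩

/-- The denotation `ρ` extended by the objects `x` for `k` new names. -/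
def extend {L : Vocabulary} {m k : ℕ} (ρ : Fin m → Obj L) {δ : Fin L.numDom}
    (x : Fin k → Fin (L.size δ)) : Fin (m + k) → Obj L :=
  Fin.append ρ fun i => ⟨δ, x i⟩

open Classical in
/-- The randvars that belong to two different members, with indices in `s`, of a family of sets. -/
noncomputable def shared {L : Vocabulary} {ι : Type} (s : Finset ι)
    (f : ι → Finset (Randvar L)) : Finset (Randvar L) :=
  Finset.univ.filter fun a => ∃ i ∈ s, ∃ j ∈ s, i ≠ j ∧ a ∈ f i ∧ a ∈ f j

namespace FODtree

variable {L : Vocabulary}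

/-- The number of nodes. -/
def numNodes : {m : ℕ} → FODtree L m → ℕ
  | _, leaf _ _ _ => 1
  | _, node _ _ ts => 1 + ∑ i, numNodes (ts i)
  | _, dpg _ k _ _ t => 1 + (1 + ∑ _π : Equiv.Perm (Fin k), numNodes t)

/-- The largest domain size of a logvar (a logvar of the tree is one of some DPG node). -/
def logvarDomain : {m : ℕ} → FODtree L m → ℕ
  | _, leaf _ _ _ => 0
  | _, node _ _ ts => Finset.univ.sup fun i => logvarDomain (ts i)
  | _, dpg δ _ _ _ t => max (L.size δ) (logvarDomain t)

/-- The object with the name `j` occurs in each leaf. -/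
def Mentions : {m : ℕ} → FODtree L m → Fin m → Prop
  | _, leaf _ args _, j => ∃ i a, (args i).2 a = j
  | _, node _ _ ts, j => ∀ i, Mentions (ts i) j
  | _, dpg _ k _ _ t, j => Mentions t (Fin.castAdd k j)

/-- The randvars under (the root of) a tree in the dtree that it defines, where the names in
scope denote the objects `ρ`. In this dtree a DPG node has one child for each `k`-subset of objects. -/
def rv : {m : ℕ} → FODtree L m → (Fin m → Obj L) → Finset (Randvar L)
  | _, leaf _ args _, ρ => Finset.univ.image fun i => (args i).ground ρ
  | _, node _ _ ts, ρ => Finset.univ.biUnion fun i => rv (ts i) ρ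
  | _, dpg δ k _ _ t, ρ => (subsets ρ δ k).biUnion fun x =>
      Finset.univ.biUnion fun π : Equiv.Perm (Fin k) => rv t (extend ρ (x ∘ π))

/-- The randvars under the child `T_𝐱` of a DPG node when `𝐱` denotes the objects `x`. -/
def rvInst {m k : ℕ} {δ : Fin L.numDom} (t : FODtree L (m + k)) (ρ : Fin m → Obj L)
    (x : Fin k → Fin (L.size δ)) : Finset (Randvar L) :=
  Finset.univ.biUnion fun π : Equiv.Perm (Fin k) => t.rv (extend ρ (x ∘ π))

/-- The cutset of a node. Here `A` is the union of the cutsets of the ancestors. -/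
noncomputable def cutset : {m : ℕ} → FODtree L m → (Fin m → Obj L) → Finset (Randvar L) →
    Finset (Randvar L)
  | _, leaf _ _ _, _, _ => ∅
  | _, node _ _ ts, ρ, A => shared Finset.univ (fun i => (ts i).rv ρ) \ A
  | _, dpg δ k _ _ t, ρ, A => shared (subsets ρ δ k) (fun x => t.rvInst ρ x) \ A

/-- The cutset of the child `T_𝐱` of a DPG node when `𝐱` denotes the objects `x`. -/
noncomputable def cutsetInst {m k : ℕ} {δ : Fin L.numDom} (t : FODtree L (m + k))
    (ρ : Fin m → Obj L) (A : Finset (Randvar L)) (x : Fin k → Fin (L.size δ)) :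
    Finset (Randvar L) :=
  shared Finset.univ (fun π : Equiv.Perm (Fin k) => t.rv (extend ρ (x ∘ π))) \ A

/-- The grouping at the root (there is nothing to group at a leaf). -/
def rootLabel : {m : ℕ} → FODtree L m → PRV L m → ℕ
  | _, leaf _ _ _ => fun _ => 0
  | _, node l _ _ => l
  | _, dpg _ _ l _ _ => l

/-- The context of a node, `rv ∩ A`. -/
noncomputable def context {m : ℕ} (t : FODtree L m) (ρ : Fin m → Obj L)
    (A : Finset (Randvar L)) : CSet L m :=
  ⟨ρ, t.rv ρ ∩ A, t.rootLabel⟩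

/-- The cluster of a node: `rv` for a leaf, and `cutset ∪ context` otherwise. -/
noncomputable def cluster : {m : ℕ} → FODtree L m → (Fin m → Obj L) → Finset (Randvar L) →
    CSet L m
  | _, leaf s args φ, ρ, _ => ⟨ρ, (leaf s args φ).rv ρ, fun _ => 0⟩
  | _, node l r ts, ρ, A => ⟨ρ, (node l r ts).cutset ρ A ∪ ((node l r ts).rv ρ ∩ A), l⟩
  | _, dpg δ k l l' t, ρ, A =>
      ⟨ρ, (dpg δ k l l' t).cutset ρ A ∪ ((dpg δ k l l' t).rv ρ ∩ A), l⟩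

/-- The context of the child `T_𝐱` of a DPG node when `𝐱` denotes the objects `x`. -/
noncomputable def contextInst {m k : ℕ} {δ : Fin L.numDom} (l' : PRV L (m + k) → ℕ)
    (t : FODtree L (m + k)) (ρ : Fin m → Obj L) (A : Finset (Randvar L))
    (x : Fin k → Fin (L.size δ)) : CSet L (m + k) :=
  ⟨extend ρ x, t.rvInst ρ x ∩ A, l'⟩

/-- The cluster of the child `T_𝐱` of a DPG node when `𝐱` denotes the objects `x`. -/
noncomputable def clusterInst {m k : ℕ} {δ : Fin L.numDom} (l' : PRV L (m + k) → ℕ)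
    (t : FODtree L (m + k)) (ρ : Fin m → Obj L) (A : Finset (Randvar L))
    (x : Fin k → Fin (L.size δ)) : CSet L (m + k) :=
  ⟨extend ρ x, t.cutsetInst ρ A x ∪ (t.rvInst ρ x ∩ A), l'⟩

open Classical in
/-- The clusters of all nodes. The representative objects of a DPG node may denote any `k`-subset of
objects. The choice is immaterial, because the resulting trees are isomorphic. -/
noncomputable def clusters : {m : ℕ} → FODtree L m → (Fin m → Obj L) → Finset (Randvar L) →
    Finset (Σ m, CSet L m)
  | m, leaf s args φ, ρ, A => {⟨m, (leaf s args φ).cluster ρ A⟩}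
  | m, node l r ts, ρ, A =>
      insert ⟨m, (node l r ts).cluster ρ A⟩
        (Finset.univ.biUnion fun i => clusters (ts i) ρ (A ∪ (node l r ts).cutset ρ A))
  | m, dpg δ k l l' t, ρ, A =>
      insert ⟨m, (dpg δ k l l' t).cluster ρ A⟩
        ((subsets ρ δ k).biUnion fun x =>
          insert ⟨m + k, clusterInst l' t ρ (A ∪ (dpg δ k l l' t).cutset ρ A) x⟩
            (Finset.univ.biUnion fun π : Equiv.Perm (Fin k) =>
              clusters t (extend ρ (x ∘ π))
                ((A ∪ (dpg δ k l l' t).cutset ρ A) ∪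
                  t.cutsetInst ρ (A ∪ (dpg δ k l l' t).cutset ρ A) x)))

/-- The requirements on DPG nodes: there is at least one logvar, the representative objects can denote
objects that satisfy the constraint, and each leaf under the node has all of them. -/
def WellFormed : {m : ℕ} → FODtree L m → (Fin m → Obj L) → Prop
  | _, leaf _ _ _, _ => True
  | _, node _ _ ts, ρ => ∀ i, WellFormed (ts i) ρ
  | m, dpg δ k _ _ t, ρ => 0 < k ∧ (subsets ρ δ k).Nonempty ∧
      (∀ i : Fin k, t.Mentions (Fin.natAdd m i)) ∧
      ∀ x ∈ subsets ρ δ k, ∀ π : Equiv.Perm (Fin k), WellFormed t (extend ρ (x ∘ π))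

/-- The counting randvars of a set `C` at a child are obtained from those of the cluster
`S` of its parent by restriction: PRVs in one tuple at the child are in one tuple at the
parent. -/
def Refines {m m' : ℕ} (C : CSet L m') (S : CSet L m) : Prop :=
  ∀ p ∈ C.prvs, ∀ q ∈ C.prvs, p.dom = q.dom → C.label p = C.label q →
    ∀ p' ∈ S.prvs, ∀ q' ∈ S.prvs,
      (∃ a, p.Represents C.env a ∧ p'.Represents S.env a) →
      (∃ a, q.Represents C.env a ∧ q'.Represents S.env a) → S.label p' = S.label q'

/-- The grouping of PRVs into counting randvars can be carried out by counting
conversions. Counting conversion of the logvars of a DPG node produces one counting randvar from all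
PRVs of their domain, and tuples can only become larger on the way from a node to its parent. -/
def WellCounted : {m : ℕ} → FODtree L m → (Fin m → Obj L) → Finset (Randvar L) → Prop
  | _, leaf _ _ _, _, _ => True
  | _, node l r ts, ρ, A => ∀ i,
      Refines ((ts i).context ρ (A ∪ (node l r ts).cutset ρ A)) ((node l r ts).cluster ρ A) ∧
      WellCounted (ts i) ρ (A ∪ (node l r ts).cutset ρ A)
  | _, dpg δ k l l' t, ρ, A =>
      (∀ p ∈ ((dpg δ k l l' t).cluster ρ A).prvs, ∀ q ∈ ((dpg δ k l l' t).cluster ρ A).prvs,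
        p.dom = δ → q.dom = δ → l p = l q) ∧
      ∀ x ∈ subsets ρ δ k,
        Refines (contextInst l' t ρ (A ∪ (dpg δ k l l' t).cutset ρ A) x)
          ((dpg δ k l l' t).cluster ρ A) ∧
        ∀ π : Equiv.Perm (Fin k),
          Refines
            (t.context (extend ρ (x ∘ π)) ((A ∪ (dpg δ k l l' t).cutset ρ A) ∪
              t.cutsetInst ρ (A ∪ (dpg δ k l l' t).cutset ρ A) x))
            (clusterInst l' t ρ (A ∪ (dpg δ k l l' t).cutset ρ A) x) ∧
          WellCounted t (extend ρ (x ∘ π)) ((A ∪ (dpg δ k l l' t).cutset ρ A) ∪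
            t.cutsetInst ρ (A ∪ (dpg δ k l l' t).cutset ρ A) x)

/-- A counted liftable FO-dtree. The names in scope at its root are the constants of the model and
denote the distinct objects `ρ`. -/
structure IsCountedLiftable {m : ℕ} (T : FODtree L m) (ρ : Fin m → Obj L) : Prop where
  env_injective : Function.Injective ρ
  wellFormed : T.WellFormed ρ
  wellCounted : T.WellCounted ρ ∅
  liftable : ∀ S ∈ T.clusters ρ ∅, S.2.Liftable

/-- First component of the lifted width: the largest ground width of a cluster. -/
noncomputable def groundWidth {m : ℕ} (T : FODtree L m) (ρ : Fin m → Obj L) : ℕ :=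
  (T.clusters ρ ∅).sup fun S => S.2.groundWidth

/-- Second component of the lifted width: the largest counting width of a cluster. -/
noncomputable def countingWidth {m : ℕ} (T : FODtree L m) (ρ : Fin m → Obj L) : ℕ :=
  (T.clusters ρ ∅).sup fun S => S.2.countingWidth

/-- The largest range size of a ground randvar in a cluster. -/
noncomputable def groundRange {m : ℕ} (T : FODtree L m) (ρ : Fin m → Obj L) : ℕ :=
  (T.clusters ρ ∅).sup fun S => S.2.groundRange

/-- The largest domain size of a counted logvar. -/
noncomputable def countedDomain {m : ℕ} (T : FODtree L m) (ρ : Fin m → Obj L) : ℕ :=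
  (T.clusters ρ ∅).sup fun S => S.2.countedDomain

/-- The largest range size of a tuple of counted randvars. -/
noncomputable def countedRange {m : ℕ} (T : FODtree L m) (ρ : Fin m → Obj L) : ℕ :=
  (T.clusters ρ ∅).sup fun S => S.2.countedRange

end FODtree

/-! ## Computations with a count of arithmetic operations -/

/-- The result of a computation together with the number of arithmetic operations (additions and
multiplications) on table entries that it performed. -/
structure Timed (α : Type) where
  val : α
  cost : ℕ

namespace Timed

instance : Monad Timed where
  pure a := ⟨a, 0⟩
  bind x f := ⟨(f x.val).val, x.cost + (f x.val).cost⟩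

/-- One addition. -/
noncomputable def add (x y : ℝ) : Timed ℝ := ⟨x + y, 1⟩

/-- One multiplication. -/
noncomputable def mul (x y : ℝ) : Timed ℝ := ⟨x * y, 1⟩

/-- Exponentiation by repeated squaring. -/
noncomputable def pow (x : ℝ) (e : ℕ) : Timed ℝ :=
  if _h : e = 0 then pure 1
  else do
    let y ← pow x (e / 2)
    let z ← mul y y
    if e % 2 = 1 then mul z x else pure z
termination_by e
decreasing_by omega

/-- The sum of the results of a list of computations. -/
noncomputable def sum : List (Timed ℝ) → Timed ℝ
  | [] => pure 0
  | x :: xs => do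
    let a ← x
    let b ← sum xs
    add a b

/-- The product of the results of a list of computations. -/
noncomputable def prod : List (Timed ℝ) → Timed ℝ
  | [] => pure 1
  | x :: xs => do
    let a ← x
    let b ← prod xs
    mul a b

/-- All the computations of a finite family. -/
def all {ι α : Type} [Fintype ι] (f : ι → Timed α) : Timed (ι → α) :=
  ⟨fun i => (f i).val, ∑ i, (f i).cost⟩

/-- The table with the entries `f κ` for `κ ∈ s` (other entries are never used). -/
def table {K α : Type} (s : Finset K) (f : K → Timed α) : Timed (K → α) :=
  ⟨fun κ => (f κ).val, ∑ κ ∈ s, (f κ).cost⟩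

end Timed

/-! ## Lifted variable elimination -/

open Classical in
/-- Lifted elimination: in a factor on `S` sum out the randvars that are not in `C`. An entry for the
value `κ` stands for `S.mul C κ` many assignments. -/
noncomputable def sumOut {L : Vocabulary} {m : ℕ} (S C : CSet L m) (φ : Key L m → ℝ) :
    Timed (Key L m → ℝ) :=
  Timed.table C.range fun κ =>
    Timed.sum ((S.range.filter fun κ' => C.key (S.assignment κ') = κ).toList.map fun κ' =>
      Timed.mul (S.mul C κ') (φ κ'))

/-- Lifted multiplication: the product, as a factor on `S`, of the factors `φ i` on `C i`. -/
noncomputable def multiply {L : Vocabulary} {ι : Type} [Fintype ι] {m : ℕ} {m' : ι → ℕ}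
    (S : CSet L m) (C : ∀ i, CSet L (m' i)) (φ : ∀ i, Key L (m' i) → ℝ) : Timed (Key L m → ℝ) :=
  Timed.table S.range fun κ =>
    Timed.prod ((Finset.univ : Finset ι).toList.map fun i =>
      pure (φ i ((C i).key (S.assignment κ))))

/-- The joint values, under the assignment `g`, of the PRVs of the domain `δ` in `S`, for the members
of the `k`-subset `x` of `δ`: a multiset of `k` values. -/
noncomputable def profile {L : Vocabulary} {m k : ℕ} {δ : Fin L.numDom} (S : CSet L m)
    (g : Assignment L) (x : Fin k → Fin (L.size δ)) : Multiset (PRV L m → ℕ) :=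
  Finset.univ.val.map fun i => S.tupleValue S.prvs δ g (x i)

open Classical in
/-- Lifted aggregation and counting conversion at a DPG node with the cluster `S`: the product, as a
factor on `S`, of the isomorphic factors on the sets `C x`, for all `x` in the set `s` of `k`-subsets
of `δ`, each of which is given by the same table `φ`. The `k`-subsets with one profile make equal
contributions, so that their product is a power. If no PRV in `S` has the domain
`δ`, then there is only one profile, and each entry is one exponentiation. -/
noncomputable def aggregate {L : Vocabulary} {m k : ℕ} {δ : Fin L.numDom} (S : CSet L m)
    (s : Finset (Fin k → Fin (L.size δ))) (C : (Fin k → Fin (L.size δ)) → CSet L (m + k))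
    (φ : Key L (m + k) → ℝ) : Timed (Key L m → ℝ) :=
  Timed.table S.range fun κ =>
    Timed.prod ((s.image (profile S (S.assignment κ))).toList.map fun v =>
      if h : ∃ x ∈ s, profile S (S.assignment κ) x = v then
        Timed.pow (φ ((C h.choose).key (S.assignment κ)))
          (s.filter fun x => profile S (S.assignment κ) x = v).card
      else pure 1)

open Classical in
/-- Lifted variable elimination along a counted FO-dtree, bottom-up. Each node sends to its
parent a factor on its context. At a DPG node the child `T_𝐱` is solved for only one
choice of objects. At the root of the whole tree, where `A = ∅`, the result is a factor on no randvars
at all: the sum, over all assignments to the randvars under the tree, of the product of all its ground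
factors. -/
noncomputable def FODtree.lve {L : Vocabulary} : {m : ℕ} → FODtree L m → (Fin m → Obj L) →
    Finset (Randvar L) → Timed (Key L m → ℝ)
  | _, .leaf s args φ, ρ, A =>
      sumOut ((leaf s args φ).cluster ρ A) ((leaf s args φ).context ρ A) fun κ =>
        φ fun i => ((leaf s args φ).cluster ρ A).assignment κ ((args i).ground ρ)
  | _, .node l r ts, ρ, A => do
      let A' := A ∪ (node l r ts).cutset ρ A
      let msg ← Timed.all fun i => lve (ts i) ρ A'
      let φ ← multiply ((node l r ts).cluster ρ A) (fun i => (ts i).context ρ A') msg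
      sumOut ((node l r ts).cluster ρ A) ((node l r ts).context ρ A) φ
  | _, .dpg δ k l l' t, ρ, A =>
      let A' := A ∪ (dpg δ k l l' t).cutset ρ A
      if h : (subsets ρ δ k).Nonempty then do
        let x := h.choose
        let A'' := A' ∪ t.cutsetInst ρ A' x
        let msg ← Timed.all fun π : Equiv.Perm (Fin k) => lve t (extend ρ (x ∘ π)) A''
        let φ ← multiply (clusterInst l' t ρ A' x)
          (fun π : Equiv.Perm (Fin k) => t.context (extend ρ (x ∘ π)) A'') msg
        let ψ ← sumOut (clusterInst l' t ρ A' x) (contextInst l' t ρ A' x) φ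
        let χ ← aggregate ((dpg δ k l l' t).cluster ρ A) (subsets ρ δ k)
          (contextInst l' t ρ A') ψ
        sumOut ((dpg δ k l l' t).cluster ρ A) ((dpg δ k l l' t).context ρ A) χ
      else pure fun _ => 1

end Lifted

/-!
The work at a node is a bounded number of passes over the table of its cluster, so everything rests
on the size of these tables and on the one step that is dearer than a pass: the aggregation at a DPG
node.

*Size of a table.* A counting randvar whose tuple has `r` values and whose logvar ranges over `N`
objects takes at most `r.multichoose N` values (histograms are multisets of `N` values of the tuple),
and `r.multichoose N ≤ n ^ r` whenever `N ≤ n` and `2 ≤ n` (`multichoose_le_pow`). Hence the table of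
a cluster has at most `d ^ w_g * n_# ^ (w_# * r_#)` entries (`CSet.card_range_le`).

*Aggregation.* An entry of the aggregated factor is a product of one power for each profile, that is,
for each multiset of `k` tuple values that some `k`-subset of the domain realizes. There may be
`r.multichoose k` of them, which no constant bounds. However, all PRVs of the domain of the DPG node
form one single counting randvar, and its `r.multichoose N` histograms leave room below `n ^ r`:
`r.multichoose N * r.multichoose k * k ≤ 8192 * k! * n ^ r` for `0 < k ≤ N`
(`multichoose_mul_multichoose_le`). The factor `k!` is paid for by the `k!` children of the
representative child `T_𝐱`, and the factor `k` comes from the repeated squaring, because the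
exponents are at most the `k`-th power of the domain size.

*Summation over the tree.* `FODtree.lve_cost_le` adds up these costs by induction on the tree. Its
induction hypothesis leaves some slack at each node, with which a child pays for its share in the
product that is formed at its parent, and also for its share in the aggregation above.
-/

namespace Lifted

/-! ### Bounds for the number of multisets -/

theorem succ_mul_multichoose_succ (r N : ℕ) :
    r * (r + 1).multichoose N = (N + r) * r.multichoose N := by
  rcases r with _ | r
  · rcases N with _ | N <;> simp
  · rw [Nat.multichoose_eq, Nat.multichoose_eq]
    have h := Nat.add_one_mul_choose_eq (N + r) r
    have e1 : r + 1 + 1 + N - 1 = N + r + 1 := by omega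
    have e2 : r + 1 + N - 1 = N + r := by omega
    rw [e1, e2, ← Nat.choose_symm_of_eq_add (show N + r + 1 = (r + 1) + N by ring),
      ← Nat.choose_symm_of_eq_add (show N + r = r + N by ring)]
    linarith

/-- In the induction on `r`, the quotient of consecutive values of `multichoose` is `(N + r) / r`,
which is at most `n` from `r = 2` on. -/
theorem multichoose_le_pow {r n N : ℕ} (hr : 0 < r) (hn : 2 ≤ n) (hN : N ≤ n) :
    r.multichoose N ≤ n ^ r := by
  induction r, hr using Nat.le_induction with
  | base => simp only [Nat.multichoose_one, pow_one]; omega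
  | succ r hr ih =>
    rcases hr.eq_or_lt with rfl | hr'
    · change Nat.multichoose 2 N ≤ n ^ 2
      rw [Nat.multichoose_two]
      nlinarith
    · refine Nat.le_of_mul_le_mul_left (c := r) ?_ hr
      have h : N + r ≤ r * n := by nlinarith
      calc r * (r + 1).multichoose N = (N + r) * r.multichoose N := succ_mul_multichoose_succ r N
        _ ≤ (r * n) * n ^ r := Nat.mul_le_mul h ih
        _ = r * n ^ (r + 1) := by ring

theorem multichoose_le_succ_pow (r N : ℕ) : (r + 1).multichoose N ≤ (N + 1) ^ r := by
  induction r with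
  | zero => simp
  | succ r ih =>
    refine Nat.le_of_mul_le_mul_left (c := r + 1) ?_ (by omega)
    have h : N + (r + 1) ≤ (r + 1) * (N + 1) := by nlinarith [Nat.zero_le (r * N)]
    calc (r + 1) * (r + 1 + 1).multichoose N = (N + (r + 1)) * (r + 1).multichoose N :=
          succ_mul_multichoose_succ (r + 1) N
      _ ≤ ((r + 1) * (N + 1)) * (N + 1) ^ r := Nat.mul_le_mul h ih
      _ = (r + 1) * (N + 1) ^ (r + 1) := by ring

/-- Histograms of at least three objects are fewer than `N ^ r` by an exponential factor. The quotient
of consecutive values of `multichoose` is `(N + r) / r`, which is at most `N / 2` from `r = 6` on; the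
smaller `r` determine the constant `4096 = 4 ^ 6`. -/
theorem two_pow_mul_multichoose_le {r N : ℕ} (hr : 0 < r) (hN : 3 ≤ N) :
    2 ^ r * r.multichoose N ≤ 4096 * N ^ r := by
  by_cases h6 : r ≤ 6
  · obtain ⟨r, rfl⟩ : ∃ s, r = s + 1 := ⟨r - 1, by omega⟩
    have h4 : 4 ^ (r + 1) ≤ 4 ^ 6 := Nat.pow_le_pow_right (by norm_num) h6
    calc 2 ^ (r + 1) * (r + 1).multichoose N ≤ 2 ^ (r + 1) * (2 * N) ^ r :=
          Nat.mul_le_mul_left _ ((multichoose_le_succ_pow r N).trans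
            (Nat.pow_le_pow_left (by omega) r))
      _ ≤ 2 ^ (r + 1) * (2 * N) ^ (r + 1) :=
          Nat.mul_le_mul_left _ (Nat.pow_le_pow_right (by omega) (by omega))
      _ = 4 ^ (r + 1) * N ^ (r + 1) := by
          rw [mul_pow, ← mul_assoc, ← mul_pow]; norm_num
      _ ≤ 4096 * N ^ (r + 1) := Nat.mul_le_mul_right _ h4
  · have h6' : 6 ≤ r := by omega
    clear h6
    induction r, h6' using Nat.le_induction with
    | base =>
      have := multichoose_le_succ_pow 5 N
      calc 2 ^ 6 * Nat.multichoose 6 N ≤ 2 ^ 6 * (2 * N) ^ 5 :=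
            Nat.mul_le_mul_left _ (this.trans (Nat.pow_le_pow_left (by omega) 5))
        _ ≤ 2 ^ 6 * (2 * N) ^ 6 :=
            Nat.mul_le_mul_left _ (Nat.pow_le_pow_right (by omega) (by omega))
        _ = 4096 * N ^ 6 := by ring
    | succ r h6 ih =>
      refine Nat.le_of_mul_le_mul_left (c := r) ?_ (by omega)
      have h : 2 * (N + r) ≤ r * N := by nlinarith
      calc r * (2 ^ (r + 1) * (r + 1).multichoose N)
          = 2 ^ (r + 1) * (r * (r + 1).multichoose N) := by ring
        _ = (2 * (N + r)) * (2 ^ r * r.multichoose N) := by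
            rw [succ_mul_multichoose_succ]; ring
        _ ≤ (r * N) * (4096 * N ^ r) := Nat.mul_le_mul h (ih (by omega))
        _ = r * (4096 * N ^ (r + 1)) := by ring

theorem mul_two_pow_le_factorial {k : ℕ} (hk : 0 < k) : k * 2 ^ k ≤ 4 * k.factorial := by
  induction k, hk using Nat.le_induction with
  | base => simp
  | succ k hk ih =>
    rw [Nat.factorial_succ]
    rcases hk.eq_or_lt with rfl | hk'
    · simp
    · calc (k + 1) * 2 ^ (k + 1) = (k + 1) * (2 * 2 ^ k) := by ring
        _ ≤ (k + 1) * (k * 2 ^ k) := by gcongr; omega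
        _ ≤ (k + 1) * (4 * k.factorial) := by gcongr
        _ = 4 * ((k + 1) * k.factorial) := by ring

/-- Once `k!` is available, the number of profiles is at most exponential in `r`, uniformly in `k`. -/
theorem multichoose_mul_le {r k : ℕ} (hr : 0 < r) (hk : 0 < k) :
    r.multichoose k * k ≤ 2 * k.factorial * 2 ^ r := by
  obtain ⟨r, rfl⟩ : ∃ s, r = s + 1 := ⟨r - 1, by omega⟩
  have h1 : (r + 1).multichoose k ≤ 2 ^ (r + k) := by
    rw [Nat.multichoose_eq, show r + 1 + k - 1 = r + k by omega]
    exact Nat.choose_le_two_pow _ _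
  calc (r + 1).multichoose k * k ≤ 2 ^ (r + k) * k := by gcongr
    _ = 2 ^ r * (k * 2 ^ k) := by ring
    _ ≤ 2 ^ r * (4 * k.factorial) := Nat.mul_le_mul_left _ (mul_two_pow_le_factorial hk)
    _ = 2 * k.factorial * 2 ^ (r + 1) := by ring

theorem succ_pow_four_le (r : ℕ) : (r + 1) ^ 4 ≤ 4096 * 2 ^ r := by
  by_cases h : r ≤ 5
  · interval_cases r <;> norm_num
  · have h' : 5 ≤ r := by omega
    clear h
    induction r, h' using Nat.le_induction with
    | base => norm_num
    | succ r hr ih =>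
      have h2 : (r + 1 + 1) ^ 2 * 5 ≤ (r + 1) ^ 2 * 7 := by nlinarith
      have : (r + 1 + 1) ^ 4 * 25 ≤ (r + 1) ^ 4 * 49 := by
        calc (r + 1 + 1) ^ 4 * 25 = ((r + 1 + 1) ^ 2 * 5) * ((r + 1 + 1) ^ 2 * 5) := by ring
          _ ≤ ((r + 1) ^ 2 * 7) * ((r + 1) ^ 2 * 7) := Nat.mul_le_mul h2 h2
          _ = _ := by ring
      rw [pow_succ 2]
      omega

theorem multichoose_le_succ_sq {r k : ℕ} (hk : k ≤ 2) : r.multichoose k ≤ (r + 1) ^ 2 := by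
  rcases r with _ | r
  · rcases k with _ | k <;> simp
  interval_cases k
  · rw [Nat.multichoose_zero_right]; exact Nat.one_le_pow _ _ (by omega)
  · simp only [Nat.multichoose_one_right]; nlinarith
  · have : ∀ r, 2 * Nat.multichoose r 2 = r * (r + 1) := by
      intro r
      induction r with
      | zero => simp
      | succ r ih =>
        rw [Nat.multichoose_succ_succ, mul_add, ih, Nat.multichoose_one_right]; ring
    nlinarith [this (r + 1)]

/-- The number of histograms of `N` objects times the number of multisets of `k ≤ N` values times `k`
exceeds `n ^ r` only by a constant multiple of `k!`. For `N ≥ 3` the exponential gap in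
`two_pow_mul_multichoose_le` absorbs the multisets; for `N ≤ 2` the left side is a polynomial in `r`. -/
theorem multichoose_mul_multichoose_le {r N k n : ℕ} (hr : 0 < r) (hk : 0 < k) (hkN : k ≤ N)
    (hN : N ≤ n) (hn : 2 ≤ n) :
    r.multichoose N * (r.multichoose k * k) ≤ 8192 * k.factorial * n ^ r := by
  by_cases h3 : 3 ≤ N
  · calc r.multichoose N * (r.multichoose k * k)
        ≤ r.multichoose N * (2 * k.factorial * 2 ^ r) :=
          Nat.mul_le_mul_left _ (multichoose_mul_le hr hk)
      _ = 2 * k.factorial * (2 ^ r * r.multichoose N) := by ring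
      _ ≤ 2 * k.factorial * (4096 * N ^ r) :=
          Nat.mul_le_mul_left _ (two_pow_mul_multichoose_le hr h3)
      _ = 8192 * k.factorial * N ^ r := by ring
      _ ≤ 8192 * k.factorial * n ^ r := by gcongr
  · have h1 : r.multichoose N ≤ (r + 1) ^ 2 := multichoose_le_succ_sq (by omega)
    have h2 : r.multichoose k ≤ (r + 1) ^ 2 := multichoose_le_succ_sq (by omega)
    calc r.multichoose N * (r.multichoose k * k)
        ≤ (r + 1) ^ 2 * ((r + 1) ^ 2 * k.factorial) :=
          Nat.mul_le_mul h1 (Nat.mul_le_mul h2 (Nat.self_le_factorial k))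
      _ = (r + 1) ^ 4 * k.factorial := by ring
      _ ≤ (4096 * 2 ^ r) * k.factorial := Nat.mul_le_mul_right _ (succ_pow_four_le r)
      _ ≤ (8192 * n ^ r) * k.factorial := by gcongr; norm_num
      _ = 8192 * k.factorial * n ^ r := by ring

/-- There are at most `V.card.multichoose N` multisets of `N` elements of `V`. -/
theorem card_image_le_multichoose {ι α : Type*} [DecidableEq α] [DecidableEq (Multiset α)]
    (s : Finset ι) (f : ι → Multiset α) (V : Finset α) (N : ℕ) (hcard : ∀ i ∈ s, (f i).card = N)
    (hmem : ∀ i ∈ s, ∀ v ∈ f i, v ∈ V) : (s.image f).card ≤ V.card.multichoose N := by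
  have hsub : s.image f ⊆
      (Finset.univ : Finset (Sym V N)).image fun z => (z.1).map Subtype.val := by
    intro M hM
    obtain ⟨i, hi, rfl⟩ := Finset.mem_image.1 hM
    refine Finset.mem_image.2 ⟨(⟨(f i).attach.map fun v => ⟨v.1, hmem i hi v.1 v.2⟩, ?_⟩ : Sym V N),
      Finset.mem_univ _, ?_⟩
    · simp [hcard i hi]
    · simp [Multiset.map_map]
  refine (Finset.card_le_card hsub).trans (Finset.card_image_le.trans ?_)
  rw [Finset.card_univ, Sym.card_sym_eq_multichoose, Fintype.card_coe]

/-! ### Costs of the elementary computations -/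

theorem pow_cost_le (x : ℝ) : ∀ (j e : ℕ), e < 2 ^ j → (Timed.pow x e).cost ≤ 2 * j
  | 0, e, h => by
    obtain rfl : e = 0 := by simpa using h
    rw [Timed.pow]; simp [pure]
  | j + 1, e, h => by
    have ih := pow_cost_le x j (e / 2) (by rw [pow_succ] at h; omega)
    rw [Timed.pow]
    split_ifs <;> simp only [bind, Timed.mul, pure] <;> omega

theorem sum_cost (l : List (Timed ℝ)) : (Timed.sum l).cost = (l.map fun x => x.cost + 1).sum := by
  induction l with
  | nil => rfl
  | cons x l ih =>
    simp only [Timed.sum, bind, Timed.add, List.map_cons, List.sum_cons]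
    omega

theorem prod_cost (l : List (Timed ℝ)) : (Timed.prod l).cost = (l.map fun x => x.cost + 1).sum := by
  induction l with
  | nil => rfl
  | cons x l ih =>
    simp only [Timed.prod, bind, Timed.mul, List.map_cons, List.sum_cons]
    omega

/-- Summing out is one pass over the table of `S`, because each entry of that table contributes to one
entry of the result. -/
theorem sumOut_cost_le {L : Vocabulary} {m : ℕ} (S C : CSet L m) (φ : Key L m → ℝ) :
    (sumOut S C φ).cost ≤ 2 * S.range.card := by
  classical
  simp only [sumOut, Timed.table, sum_cost, List.map_map, Function.comp_def, Timed.mul]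
  simp only [List.map_const', List.sum_replicate, Finset.length_toList, smul_eq_mul]
  rw [← Finset.sum_mul, mul_comm]
  gcongr
  rw [← Finset.card_biUnion]
  · exact Finset.card_le_card (Finset.biUnion_subset.2 fun _ _ => Finset.filter_subset _ _)
  · intro a _ b _ hab
    rw [Function.onFun, Finset.disjoint_left]
    intro x hx hx'
    exact hab ((Finset.mem_filter.1 hx).2.symm.trans (Finset.mem_filter.1 hx').2)

theorem multiply_cost {L : Vocabulary} {ι : Type} [Fintype ι] {m : ℕ} {m' : ι → ℕ}
    (S : CSet L m) (C : ∀ i, CSet L (m' i)) (φ : ∀ i, Key L (m' i) → ℝ) :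
    (multiply S C φ).cost = S.range.card * Fintype.card ι := by
  simp [multiply, Timed.table, prod_cost, Function.comp_def, pure]

/-! ### The number of values of a cluster -/

namespace CSet

variable {L : Vocabulary} {m : ℕ}

open Classical in
/-- The objects of the domain `δ` that are not named: those that a logvar with domain `δ` can
denote in normal form. -/
noncomputable def unnamed (S : CSet L m) (δ : Fin L.numDom) : Finset (Fin (L.size δ)) :=
  Finset.univ.filter fun o => ∀ j, S.env j ≠ ⟨δ, o⟩

theorem card_unnamed_le (S : CSet L m) (δ : Fin L.numDom) : (S.unnamed δ).card ≤ L.size δ :=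
  (Finset.card_le_univ _).trans (Fintype.card_fin _).le

/-- The possible joint values of the PRVs in `Q` with domain `δ`, as functions on all PRVs that vanish
on the other ones. -/
def tupleRange (Q : Finset (PRV L m)) (δ : Fin L.numDom) : Finset (PRV L m → ℕ) :=
  Fintype.piFinset fun p => if p ∈ Q ∧ p.dom = δ then Finset.range p.rng else {0}

theorem card_tupleRange (Q : Finset (PRV L m)) (δ : Fin L.numDom) :
    (tupleRange Q δ).card = ∏ p ∈ Q.filter (fun p => p.dom = δ), p.rng := by
  rw [tupleRange, Fintype.card_piFinset, ← Finset.filter_univ_mem Q, Finset.filter_filter,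
    Finset.prod_filter]
  refine Finset.prod_congr rfl fun p _ => ?_
  simp only [Finset.mem_filter, Finset.mem_univ, true_and]
  split_ifs <;> simp

theorem tupleValue_mem (S : CSet L m) (Q : Finset (PRV L m)) (δ : Fin L.numDom)
    (g : Assignment L) (o : Fin (L.size δ)) : S.tupleValue Q δ g o ∈ tupleRange Q δ := by
  rw [tupleRange, Fintype.mem_piFinset]
  intro p
  by_cases h : p ∈ Q ∧ p.dom = δ
  · simp only [tupleValue, dif_pos h, if_pos h, Finset.mem_range]
    exact (g _).2
  · simp [tupleValue, h]

/-- The number of values of the tuple of PRVs inside a counting randvar. -/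
noncomputable def tupleSize (S : CSet L m) (γ : Fin L.numDom × ℕ) : ℕ := ∏ p ∈ S.tuple γ, p.rng

theorem tupleSize_pos (S : CSet L m) (γ : Fin L.numDom × ℕ) : 0 < S.tupleSize γ :=
  Finset.prod_pos fun p _ => L.rng_pos p.2.1

theorem card_tupleRange_tuple (S : CSet L m) (γ : Fin L.numDom × ℕ) :
    (tupleRange (S.tuple γ) γ.1).card = S.tupleSize γ := by
  rw [card_tupleRange, tupleSize, Finset.filter_true_of_mem]
  intro p hp
  exact congrArg Prod.fst (Finset.mem_filter.1 hp).2

open Classical in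
theorem card_histograms_le (S : CSet L m) {γ : Fin L.numDom × ℕ} (hγ : γ ∈ S.countingRvs) :
    (Finset.univ.image fun g => (S.key g).2 γ).card ≤
      (S.tupleSize γ).multichoose (S.unnamed γ.1).card := by
  have h : (Finset.univ.image fun g => (S.key g).2 γ) =
      (Finset.univ.image fun g =>
        (S.unnamed γ.1).val.map (S.tupleValue (S.tuple γ) γ.1 g)).image
          fun M v => M.count v := by
    rw [Finset.image_image]
    refine Finset.image_congr fun g _ => ?_
    funext v
    simp only [key, if_pos hγ, Function.comp_apply, Multiset.count_map]
    rw [unnamed, ← Finset.filter_filter, ← Finset.filter_val, ← Finset.card_def]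
    simp only [eq_comm]
  rw [h, ← card_tupleRange_tuple]
  refine Finset.card_image_le.trans (card_image_le_multichoose _ _ _ _ ?_ ?_)
  · simp
  · intro g _ v hv
    obtain ⟨o, _, rfl⟩ := Multiset.mem_map.1 hv
    exact tupleValue_mem S _ _ g o

/-- The range of a set injects into the product of the ranges of its ground randvars and of the sets
of histograms of its counting randvars. -/
theorem card_range_le_prod (S : CSet L m) :
    S.range.card ≤ S.groundRange ^ S.groundWidth *
      ∏ γ ∈ S.countingRvs, (S.tupleSize γ).multichoose (S.unnamed γ.1).card := by
  classical
  let G : Finset (RepRandvar L m → ℕ) := Fintype.piFinset fun a =>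
    if a ∈ S.groundRvs then Finset.range (L.rng a.1) else {0}
  let H : Finset (S.countingRvs → (PRV L m → ℕ) → ℕ) := Fintype.piFinset fun γ =>
    Finset.univ.image fun g => (S.key g).2 γ
  have hmaps : Set.MapsTo (fun κ : Key L m => (κ.1, fun γ : S.countingRvs => κ.2 γ))
      S.range (G ×ˢ H : Finset _) := by
    intro κ hκ
    obtain ⟨g, _, rfl⟩ := Finset.mem_image.1 hκ
    refine Finset.mem_product.2 ⟨Fintype.mem_piFinset.2 fun a => ?_,
      Fintype.mem_piFinset.2 fun γ => Finset.mem_image_of_mem (fun g => (S.key g).2 γ) (Finset.mem_univ _)⟩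
    by_cases ha : a ∈ S.groundRvs
    · simp only [key, if_pos ha, Finset.mem_range]
      exact (g _).2
    · simp [key, ha]
  have hinj : Set.InjOn (fun κ : Key L m => (κ.1, fun γ : S.countingRvs => κ.2 γ)) S.range := by
    intro κ hκ κ' hκ' h
    obtain ⟨g, _, rfl⟩ := Finset.mem_image.1 hκ
    obtain ⟨g', _, rfl⟩ := Finset.mem_image.1 hκ'
    obtain ⟨h1, h2⟩ := Prod.mk.inj h
    refine Prod.ext h1 ?_
    funext γ
    by_cases hγ : γ ∈ S.countingRvs
    · exact congrFun h2 ⟨γ, hγ⟩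
    · simp [key, hγ]
  refine (Finset.card_le_card_of_injOn _ hmaps hinj).trans ?_
  rw [Finset.card_product]
  refine Nat.mul_le_mul ?_ ?_
  · rw [Fintype.card_piFinset, groundWidth]
    calc ∏ a, (if a ∈ S.groundRvs then Finset.range (L.rng a.1) else {0}).card
        = ∏ a ∈ S.groundRvs, L.rng a.1 := by
          rw [← Finset.prod_filter_mul_prod_filter_not Finset.univ (· ∈ S.groundRvs),
            Finset.prod_congr rfl fun a ha => by rw [if_pos (Finset.mem_filter.1 ha).2],
            Finset.prod_congr (s₁ := Finset.univ.filter (· ∉ S.groundRvs)) rfl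
              fun a ha => by rw [if_neg (Finset.mem_filter.1 ha).2]]
          simp
      _ ≤ S.groundRange ^ S.groundRvs.card :=
          Finset.prod_le_pow_card _ _ _ fun a ha =>
            Finset.le_sup (f := fun a : RepRandvar L m => L.rng a.1) ha
  · rw [Fintype.card_piFinset, ← Finset.prod_coe_sort S.countingRvs]
    exact Finset.prod_le_prod' fun (γ : S.countingRvs) _ => S.card_histograms_le γ.2

/-- The bound `d ^ w_g * n ^ (w_# * r)` for the number of values of `S`, where `d`, `w_g` and `w_#`
belong to `S` and where `n` and `r` stand for bounds on its counted domains and on the ranges of its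
tuples. -/
noncomputable def rangeBound (S : CSet L m) (n r : ℕ) : ℕ :=
  S.groundRange ^ S.groundWidth * n ^ (S.countingWidth * r)

theorem multichoose_tupleSize_le (S : CSet L m) {n r : ℕ} (hn : 2 ≤ n) (hdom : S.countedDomain ≤ n)
    (hrng : S.countedRange ≤ r) {γ : Fin L.numDom × ℕ} (hγ : γ ∈ S.countingRvs) :
    (S.tupleSize γ).multichoose (S.unnamed γ.1).card ≤ n ^ r := by
  have h1 : L.size γ.1 ≤ n :=
    (Finset.le_sup (f := fun γ : Fin L.numDom × ℕ => L.size γ.1) hγ).trans hdom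
  have h2 : S.tupleSize γ ≤ r :=
    (Finset.le_sup (f := fun γ : Fin L.numDom × ℕ => S.tupleSize γ) hγ).trans hrng
  exact (multichoose_le_pow (S.tupleSize_pos γ) hn ((S.card_unnamed_le _).trans h1)).trans
    (Nat.pow_le_pow_right (by omega) h2)

theorem card_range_le (S : CSet L m) {n r : ℕ} (hn : 2 ≤ n) (hdom : S.countedDomain ≤ n)
    (hrng : S.countedRange ≤ r) : S.range.card ≤ S.rangeBound n r := by
  refine S.card_range_le_prod.trans (Nat.mul_le_mul_left _ ?_)
  rw [mul_comm, pow_mul]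
  exact Finset.prod_le_pow_card _ _ _ fun γ hγ => S.multichoose_tupleSize_le hn hdom hrng hγ

/-! ### Aggregation at a DPG node -/

open Classical in
theorem card_profiles_le {k : ℕ} {δ : Fin L.numDom} (S : CSet L m) (g : Assignment L)
    (s : Finset (Fin k → Fin (L.size δ))) :
    (s.image (profile S g)).card ≤
      (∏ p ∈ S.prvs.filter fun p => p.dom = δ, p.rng).multichoose k := by
  rw [← card_tupleRange]
  refine card_image_le_multichoose _ _ _ _ ?_ ?_
  · simp [profile]
  · intro x _ v hv
    obtain ⟨i, _, rfl⟩ := Multiset.mem_map.1 hv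
    exact tupleValue_mem S _ _ g _

/-- A `k`-subset that satisfies the constraint consists of `k` unnamed objects. -/
theorem le_card_unnamed {k : ℕ} {δ : Fin L.numDom} (S : CSet L m)
    (h : (subsets S.env δ k).Nonempty) : k ≤ (S.unnamed δ).card := by
  classical
  obtain ⟨x, hx⟩ := h
  obtain ⟨hmono, hne⟩ := (Finset.mem_filter.1 hx).2
  have hinj : Function.Injective x := StrictMono.injective (fun i j => hmono i j)
  have := Finset.card_le_card_of_injOn (s := Finset.univ) (t := S.unnamed δ) x
    (fun i _ => Finset.mem_filter.2 ⟨Finset.mem_univ _, hne i⟩) hinj.injOn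
  simpa using this

/-- The work of an aggregation, up to the logarithm: table entries times profiles times `k`. The
assumption on the labels says that all PRVs of the domain `δ` are in one counting randvar, whose share
`n ^ r` of the bound then covers its histograms as well as the profiles. -/
theorem card_range_mul_multichoose_le {k : ℕ} {δ : Fin L.numDom} (S : CSet L m) {n r : ℕ}
    (hn : 2 ≤ n) (hdom : S.countedDomain ≤ n) (hrng : S.countedRange ≤ r) (hk : 0 < k)
    (hs : (subsets S.env δ k).Nonempty)
    (hlabel : ∀ p ∈ S.prvs, ∀ q ∈ S.prvs, p.dom = δ → q.dom = δ → S.label p = S.label q) :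
    S.range.card * ((∏ p ∈ S.prvs.filter fun p => p.dom = δ, p.rng).multichoose k * k) ≤
      8192 * k.factorial * S.rangeBound n r := by
  -- Without PRVs of the domain `δ` there is only one profile.
  by_cases hempty : (S.prvs.filter fun p => p.dom = δ) = ∅
  · rw [hempty, Finset.prod_empty, Nat.multichoose_one, one_mul]
    have h1 := S.card_range_le hn hdom hrng
    have h2 := k.self_le_factorial
    calc S.range.card * k ≤ S.rangeBound n r * (8192 * k.factorial) :=
          Nat.mul_le_mul h1 (by omega)
      _ = _ := by ring
  · obtain ⟨q, hq⟩ := Finset.nonempty_iff_ne_empty.2 hempty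
    obtain ⟨hqS, rfl⟩ := Finset.mem_filter.1 hq
    clear hq hempty
    set γ : Fin L.numDom × ℕ := (q.dom, S.label q) with hγdef
    have hγ : γ ∈ S.countingRvs := Finset.mem_image_of_mem _ hqS
    have htuple : (S.prvs.filter fun p => p.dom = q.dom) = S.tuple γ := by
      refine Finset.filter_congr fun p hp => ?_
      rw [hγdef, Prod.mk.injEq]
      exact ⟨fun h => ⟨h, hlabel p hp q hqS h rfl⟩, And.left⟩
    have h1 : L.size q.dom ≤ n :=
      (Finset.le_sup (f := fun γ : Fin L.numDom × ℕ => L.size γ.1) hγ).trans hdom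
    have h2 : S.tupleSize γ ≤ r :=
      (Finset.le_sup (f := fun γ : Fin L.numDom × ℕ => S.tupleSize γ) hγ).trans hrng
    have hmain := multichoose_mul_multichoose_le (S.tupleSize_pos γ) hk (S.le_card_unnamed hs)
      ((S.card_unnamed_le _).trans h1) hn
    have hrest : ∏ γ' ∈ S.countingRvs.erase γ,
        (S.tupleSize γ').multichoose (S.unnamed γ'.1).card ≤ (n ^ r) ^ (S.countingWidth - 1) := by
      rw [countingWidth, ← Finset.card_erase_of_mem hγ]
      exact Finset.prod_le_pow_card _ _ _ fun γ' hγ' =>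
        S.multichoose_tupleSize_le hn hdom hrng (Finset.mem_of_mem_erase hγ')
    have hw : S.countingWidth = (S.countingWidth - 1) + 1 := by
      have : 0 < S.countingWidth := Finset.card_pos.2 ⟨γ, hγ⟩
      omega
    rw [htuple]
    change _ * ((S.tupleSize γ).multichoose k * k) ≤ _
    have hrange := S.card_range_le_prod
    rw [← Finset.mul_prod_erase _ _ hγ] at hrange
    set D := S.groundRange ^ S.groundWidth
    calc S.range.card * ((S.tupleSize γ).multichoose k * k)
        ≤ (D * ((S.tupleSize γ).multichoose (S.unnamed γ.1).card *
            (n ^ r) ^ (S.countingWidth - 1))) * ((S.tupleSize γ).multichoose k * k) := by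
          refine Nat.mul_le_mul_right _ (hrange.trans ?_)
          gcongr
      _ = D * (n ^ r) ^ (S.countingWidth - 1) * ((S.tupleSize γ).multichoose
            (S.unnamed γ.1).card * ((S.tupleSize γ).multichoose k * k)) := by ring
      _ ≤ D * (n ^ r) ^ (S.countingWidth - 1) * (8192 * k.factorial * n ^ r) := by
          refine Nat.mul_le_mul_left _ (hmain.trans ?_)
          exact Nat.mul_le_mul_left _ (Nat.pow_le_pow_right (by omega) h2)
      _ = 8192 * k.factorial * S.rangeBound n r := by
          rw [rangeBound, mul_comm S.countingWidth r, pow_mul, hw, Nat.add_sub_cancel]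
          ring

end CSet

/-- The cost of an aggregation. Each exponent is at most `(L.size δ) ^ k < 2 ^ (b * k)`, so that a power
costs at most `2 * (b * k)`; the constant is `3 * 8192`. -/
theorem aggregate_cost_le {L : Vocabulary} {m k : ℕ} {δ : Fin L.numDom} (S : CSet L m)
    (C : (Fin k → Fin (L.size δ)) → CSet L (m + k)) (φ : Key L (m + k) → ℝ) {n r b : ℕ}
    (hn : 2 ≤ n) (hdom : S.countedDomain ≤ n) (hrng : S.countedRange ≤ r) (hk : 0 < k)
    (hs : (subsets S.env δ k).Nonempty)
    (hlabel : ∀ p ∈ S.prvs, ∀ q ∈ S.prvs, p.dom = δ → q.dom = δ → S.label p = S.label q)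
    (hb : L.size δ < 2 ^ b) :
    (aggregate S (subsets S.env δ k) C φ).cost ≤
      24576 * k.factorial * (b * S.rangeBound n r) := by
  classical
  have hb1 : 0 < b := by
    rcases Nat.eq_zero_or_pos b with rfl | h
    · obtain ⟨x, _⟩ := hs
      have := (x ⟨0, hk⟩).2
      omega
    · exact h
  have hpow : ∀ (x : ℝ) (e : ℕ), e ≤ (subsets S.env δ k).card →
      (Timed.pow x e).cost + 1 ≤ 3 * (b * k) := by
    intro x e he
    have h1 : (subsets S.env δ k).card ≤ L.size δ ^ k := by
      simpa using Finset.card_le_univ (subsets S.env δ k)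
    have h2 : e < 2 ^ (b * k) := by
      rw [pow_mul]
      exact (he.trans h1).trans_lt (Nat.pow_lt_pow_left hb hk.ne')
    have h3 := pow_cost_le x (b * k) e h2
    have h4 : 0 < b * k := Nat.mul_pos hb1 hk
    omega
  have hentry : (aggregate S (subsets S.env δ k) C φ).cost ≤ ∑ _κ ∈ S.range,
      (∏ p ∈ S.prvs.filter fun p => p.dom = δ, p.rng).multichoose k * (3 * (b * k)) := by
    simp only [aggregate, Timed.table, prod_cost, List.map_map]
    refine Finset.sum_le_sum fun κ _ => ?_
    refine (List.sum_le_card_nsmul _ (3 * (b * k)) ?_).trans ?_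
    · intro c hc
      obtain ⟨v, hv, rfl⟩ := List.mem_map.1 hc
      obtain ⟨x, hx, hxv⟩ := Finset.mem_image.1 (Finset.mem_toList.1 hv)
      have h : ∃ x ∈ subsets S.env δ k, profile S (S.assignment κ) x = v := ⟨x, hx, hxv⟩
      simp only [Function.comp_apply, dif_pos h]
      exact hpow _ _ (Finset.card_filter_le _ _)
    · rw [List.length_map, Finset.length_toList, smul_eq_mul]
      exact Nat.mul_le_mul_right _ (S.card_profiles_le _ _)
  refine hentry.trans ?_
  rw [Finset.sum_const, smul_eq_mul]
  have := S.card_range_mul_multichoose_le hn hdom hrng hk hs hlabel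
  calc _ = 3 * b * (S.range.card *
        ((∏ p ∈ S.prvs.filter fun p => p.dom = δ, p.rng).multichoose k * k)) := by ring
    _ ≤ 3 * b * (8192 * k.factorial * S.rangeBound n r) := Nat.mul_le_mul_left _ this
    _ = _ := by ring

/-! ### Summation over the tree -/

/-- The running time at a node of the tree, with `2 ^ b` above the domain sizes and `B` above the sizes
of the cluster tables. The summand `24577 * (b * B)`, with `24577 = 24576 + 1`, is what a node pays at
its parent: `B` for one multiplication per table entry, and `24576 * (b * B)` for a `k!`-th of the
aggregation if the parent is the representative child of a DPG node. -/
theorem FODtree.lve_cost_le {L : Vocabulary} {n r b B : ℕ} (hn : 2 ≤ n) (hb : 0 < b) {m : ℕ}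
    (t : FODtree L m) (ρ : Fin m → Obj L) (A : Finset (Randvar L)) (hwf : t.WellFormed ρ)
    (hwc : t.WellCounted ρ A) (hdom : t.logvarDomain < 2 ^ b)
    (hS : ∀ S ∈ t.clusters ρ A,
      S.2.countedDomain ≤ n ∧ S.2.countedRange ≤ r ∧ S.2.rangeBound n r ≤ B) :
    (t.lve ρ A).cost + 24577 * (b * B) ≤ 24581 * t.numNodes * (b * B) := by
  classical
  have hBb : B ≤ b * B := Nat.le_mul_of_pos_left B hb
  have hrange : ∀ S : (Σ m, CSet L m), S.2.countedDomain ≤ n ∧ S.2.countedRange ≤ r ∧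
      S.2.rangeBound n r ≤ B → S.2.range.card ≤ B := fun S h =>
    (S.2.card_range_le hn h.1 h.2.1).trans h.2.2
  induction t generalizing A with
  | leaf s args φ =>
    have h := hrange _ (hS ⟨_, (leaf s args φ).cluster ρ A⟩ (by simp [clusters]))
    have h2 := sumOut_cost_le ((leaf s args φ).cluster ρ A) ((leaf s args φ).context ρ A)
      fun κ => φ fun i => ((leaf s args φ).cluster ρ A).assignment κ ((args i).ground ρ)
    simp only [lve, numNodes]
    dsimp only at h
    omega
  | node l q ts ih =>
    have h := hrange _ (hS ⟨_, (node l q ts).cluster ρ A⟩ (by simp [clusters]))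
    have hchild := fun i => ih i ρ (A ∪ (node l q ts).cutset ρ A) (hwf i) (hwc i).2
      ((Finset.le_sup (f := fun i => (ts i).logvarDomain) (Finset.mem_univ i)).trans_lt hdom)
      (fun S hS' => hS S (by
        simp only [clusters, Finset.mem_insert, Finset.mem_biUnion]
        exact Or.inr ⟨i, Finset.mem_univ i, hS'⟩))
    have hsum := Finset.sum_le_sum fun i (_ : i ∈ Finset.univ) => hchild i
    simp only [Finset.sum_add_distrib, ← Finset.sum_mul, ← Finset.mul_sum, Finset.sum_const,
      Finset.card_univ, Fintype.card_fin, smul_eq_mul] at hsum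
    simp only [lve, bind, Timed.all, multiply_cost, numNodes, Fintype.card_fin]
    have h2 := fun φ => sumOut_cost_le ((node l q ts).cluster ρ A) ((node l q ts).context ρ A) φ
    refine (Nat.add_le_add_right (Nat.add_le_add_left (Nat.add_le_add_left (h2 _) _) _) _).trans ?_
    dsimp only at h
    nlinarith
  | dpg δ k l l' t ih =>
    obtain ⟨hk, hne, -, hwf⟩ := hwf
    obtain ⟨hlabel, hwc⟩ := hwc
    have hx := hne.choose_spec
    have hroot := hS ⟨_, (dpg δ k l l' t).cluster ρ A⟩ (by simp [clusters])
    have hinst := hrange _ (hS ⟨_, clusterInst l' t ρ (A ∪ (dpg δ k l l' t).cutset ρ A) hne.choose⟩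
      (by
        simp only [clusters, Finset.mem_insert, Finset.mem_biUnion]
        exact Or.inr ⟨_, hx, Or.inl rfl⟩))
    have hchild := fun π : Equiv.Perm (Fin k) => ih (extend ρ (hne.choose ∘ π))
      ((A ∪ (dpg δ k l l' t).cutset ρ A) ∪
        t.cutsetInst ρ (A ∪ (dpg δ k l l' t).cutset ρ A) hne.choose)
      (hwf _ hx π) ((hwc _ hx).2 π).2 ((le_max_right _ _).trans_lt hdom)
      (fun S hS' => hS S (by
        simp only [clusters, Finset.mem_insert, Finset.mem_biUnion]
        exact Or.inr ⟨_, hx, Or.inr ⟨π, Finset.mem_univ π, hS'⟩⟩))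
    have hsum := Finset.sum_le_sum fun π (_ : π ∈ Finset.univ) => hchild π
    simp only [Finset.sum_add_distrib, Finset.sum_const, Finset.card_univ, smul_eq_mul,
      Fintype.card_perm, Fintype.card_fin] at hsum
    have hagg := fun φ => aggregate_cost_le ((dpg δ k l l' t).cluster ρ A)
      (contextInst l' t ρ (A ∪ (dpg δ k l l' t).cutset ρ A)) φ hn hroot.1 hroot.2.1 hk hne hlabel
      ((le_max_left _ _).trans_lt hdom)
    have hout := fun φ => sumOut_cost_le ((dpg δ k l l' t).cluster ρ A)
      ((dpg δ k l l' t).context ρ A) φ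
    have hout' := fun φ => sumOut_cost_le
      (clusterInst l' t ρ (A ∪ (dpg δ k l l' t).cutset ρ A) hne.choose)
      (contextInst l' t ρ (A ∪ (dpg δ k l l' t).cutset ρ A) hne.choose) φ
    have h := hrange _ hroot
    have hB := hroot.2.2
    dsimp only at h hB hinst
    simp only [lve, dif_pos hne, bind, Timed.all, multiply_cost, numNodes, Finset.sum_const,
      Finset.card_univ, smul_eq_mul, Fintype.card_perm, Fintype.card_fin]
    refine (Nat.add_le_add_right (Nat.add_le_add_left (Nat.add_le_add_left
      (Nat.add_le_add (hout' _) (Nat.add_le_add (hagg _) (hout _))) _) _) _).trans ?_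
    -- Both terms with the factor `k!` are covered by the slack of the `k!` children in `hsum`.
    have h1 : k.factorial * (b * ((dpg δ k l l' t).cluster ρ A).rangeBound n r) ≤
      k.factorial * (b * B) := by gcongr
    have h2 : (clusterInst l' t ρ (A ∪ (dpg δ k l l' t).cutset ρ A) hne.choose).range.card *
        k.factorial ≤ k.factorial * (b * B) := by
      rw [mul_comm]
      exact Nat.mul_le_mul_left _ (hinst.trans hBb)
    linarith

end Lifted

theorem theorem2 :
    ∃ K : ℝ, 0 < K ∧
      ∀ (L : Lifted.Vocabulary) (m : ℕ) (T : Lifted.FODtree L m) (ρ : Fin m → Lifted.Obj L),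
        T.IsCountedLiftable ρ →
          ((T.lve ρ ∅).cost : ℝ) ≤
            K * (T.numNodes : ℝ) * Real.log (max (T.logvarDomain : ℝ) 2) *
              (T.groundRange ρ : ℝ) ^ T.groundWidth ρ *
              (max (T.countedDomain ρ : ℝ) 2) ^ (T.countingWidth ρ * T.countedRange ρ) := by
  refine ⟨24581 * (2 / Real.log 2), by positivity, fun L m T ρ hT => ?_⟩
  set n := max (T.countedDomain ρ) 2 with hn
  set N := max T.logvarDomain 2 with hN
  set B := T.groundRange ρ ^ T.groundWidth ρ * n ^ (T.countingWidth ρ * T.countedRange ρ) with hB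
  have hcost := Lifted.FODtree.lve_cost_le (r := T.countedRange ρ) (b := Nat.log 2 N + 1) (B := B)
    (le_max_right (T.countedDomain ρ) 2) (Nat.succ_pos _) T ρ ∅ hT.wellFormed hT.wellCounted
    ((le_max_left _ _).trans_lt (Nat.lt_pow_succ_log_self one_lt_two N)) (fun S hS => by
      have h1 : S.2.groundWidth ≤ T.groundWidth ρ :=
        Finset.le_sup (f := fun S : Σ m, Lifted.CSet L m => S.2.groundWidth) hS
      have h2 : S.2.countingWidth ≤ T.countingWidth ρ :=
        Finset.le_sup (f := fun S : Σ m, Lifted.CSet L m => S.2.countingWidth) hS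
      have h3 : S.2.groundRange ≤ T.groundRange ρ :=
        Finset.le_sup (f := fun S : Σ m, Lifted.CSet L m => S.2.groundRange) hS
      have h4 : S.2.countedDomain ≤ T.countedDomain ρ :=
        Finset.le_sup (f := fun S : Σ m, Lifted.CSet L m => S.2.countedDomain) hS
      have h5 : S.2.countedRange ≤ T.countedRange ρ :=
        Finset.le_sup (f := fun S : Σ m, Lifted.CSet L m => S.2.countedRange) hS
      refine ⟨h4.trans (le_max_left _ _), h5, Nat.mul_le_mul ?_ ?_⟩
      · refine (Nat.pow_le_pow_left h3 _).trans ?_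
        -- Raising the exponent needs a positive base, which a cluster with a ground randvar provides.
        rcases Nat.eq_zero_or_pos (T.groundWidth ρ) with h0 | h0
        · rw [h0, Nat.le_zero.1 (h1.trans h0.le)]
        · refine Nat.pow_le_pow_right ?_ h1
          obtain ⟨S', hS', hw⟩ := Finset.lt_sup_iff.1 h0
          obtain ⟨a, ha⟩ := Finset.card_pos.1 hw
          exact (L.rng_pos a.1).trans_le ((Finset.le_sup
            (f := fun a : Lifted.RepRandvar L S'.1 => L.rng a.1) ha).trans (Finset.le_sup
              (f := fun S : Σ m, Lifted.CSet L m => S.2.groundRange) hS'))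
      · exact Nat.pow_le_pow_right (by omega) (Nat.mul_le_mul_right _ h2))
  have hlog : ((Nat.log 2 N + 1 : ℕ) : ℝ) ≤ 2 / Real.log 2 * Real.log N := by
    have hN2 : 2 ≤ N := le_max_right _ _
    have hl2 : 0 < Real.log 2 := Real.log_pos one_lt_two
    have h1 : (1 : ℝ) ≤ Nat.log 2 N := by
      exact_mod_cast Nat.log_pos one_lt_two hN2
    have h2 : (Nat.log 2 N : ℝ) * Real.log 2 ≤ Real.log N := by
      rw [← Real.log_pow]
      refine Real.log_le_log (by positivity) ?_
      exact_mod_cast Nat.pow_log_le_self 2 (by omega)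
    rw [div_mul_eq_mul_div, le_div_iff₀ hl2]
    push_cast
    nlinarith
  have hNcast : max (T.logvarDomain : ℝ) 2 = (N : ℝ) := by rw [hN]; push_cast; rfl
  have hncast : max (T.countedDomain ρ : ℝ) 2 = (n : ℝ) := by rw [hn]; push_cast; rfl
  rw [hNcast, hncast]
  calc ((T.lve ρ ∅).cost : ℝ)
      ≤ ((24581 * T.numNodes * ((Nat.log 2 N + 1) * B) : ℕ) : ℝ) := by
        exact_mod_cast (Nat.le_add_right _ _).trans hcost
    _ = 24581 * T.numNodes * (((Nat.log 2 N + 1 : ℕ) : ℝ) * B) := by push_cast; ring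
    _ ≤ 24581 * T.numNodes * ((2 / Real.log 2 * Real.log N) * B) := by gcongr
    _ = _ := by rw [hB]; push_cast; ring
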